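/- For $n\in\mathbb{N}$ (including $0$), $\mu\in\mathbb{C}$ and $z\in\mathbb{C}\setminus[-1,1]$ let $$P_n^{\mu}(z)=\left(\frac{z+1}{z-1}\right)^{\mu/2}\frac{1}{\Gamma(1-\mu)}\,{}_2F_1\!\left(-n,n+1;1-\mu;\frac{1-z}{2}\right)$$ be Hobson's associated Legendre function of the first kind (principal power; $ {}_2F_1(a,b;c;\cdot)/\Gamma(c)$ is continued to all $c$), and let $$Q_n^{\mu}(z)=\frac{\pi}{2}\,\frac{e^{i\pi\mu}}{\sin(\pi\mu)}\left[P_n^{\mu}(z)-(-1)^nP_n^{\mu}(-z)\right]$$ be the function of the second kind, understood at integer $\mu$ as the limit with respect to the order. For integers $0\le m\le n$ put $$U_n^m(z)=\frac{\partial P_n^{\mu}(z)}{\partial\mu}\bigg|_{\mu=m}-\frac12P_n^m(z)\ln\frac{z+1}{z-1},\qquad W_{n-1}^m(z)=\frac12\left[(-1)^nU_n^m(-z)-U_n^m(z)\right].$$ On the cut, for $-1<x<1$, let $f(x\pm i0)$ denote the limit of $f(z)$ as $z\to x$ with $\pm\operatorname{Im}z>0$, and define $$P_n^{\mu}(x)=\tfrac12\left[e^{i\pi\mu/2}P_n^{\mu}(x+i0)+e^{-i\pi\mu/2}P_n^{\mu}(x-i0)\right],$$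 $$Q_n^{\mu}(x)=\tfrac12e^{-i\pi\mu}\left[e^{-i\pi\mu/2}Q_n^{\mu}(x+i0)+e^{i\pi\mu/2}Q_n^{\mu}(x-i0)\right],$$ $$W_{n-1}^{m}(x)=\tfrac12(-1)^m\left[e^{-i\pi m/2}W_{n-1}^{m}(x+i0)+e^{i\pi m/2}W_{n-1}^{m}(x-i0)\right].$$ Then for all integers $0\le m\le n$ and all $-1<x<1$ the derivative, the limit at integer order (for $\operatorname{Im} z\neq 0$) and the boundary values involved exist, $$Q_n^m(x)=\frac12P_n^m(x)\ln\frac{1+x}{1-x}-W_{n-1}^m(x),$$ and $$W_{n-1}^m(x)=\frac12\frac{(n+m)!}{(n-m)!}\sum_{k=0}^{m-1}(-1)^k\frac{2k+1}{(n-k)(k+n+1)}\left[P_k^{-m}(-x)-(-1)^{n+m}P_k^{-m}(x)\right]$$ $$\qquad+\frac12\sum_{k=0}^{\lfloor(n-m-1)/2\rfloor}\frac{2n-4k-1}{(n-k)(2k+1)}\left[1+\frac{(n+m)!\,(n-m-2k-1)!}{(n-m)!\,(n+m-2k-1)!}\right]P_{n-2k-1}^m(x),$$ where a sum whose upper limit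 is one less than its lower limit is zero (so the first sum is empty for $m=0$ and the second for $m=n$). -/

import Mathlib

open Filter Topology
open scoped Nat

noncomputable section

/-- The associated Legendre function of the first kind `P_n^μ(z)` off the cut (Hobson), of degree
`n` and complex order `μ`:
`P_n^μ(z) = (1 / Γ(1 - μ)) ((z + 1) / (z - 1))^(μ / 2) ₂F₁(-n, n + 1; 1 - μ; (1 - z) / 2)`.
The regularized hypergeometric function is `₂F₁(a, b; c; w) / Γ(c)`, continued to all `c`.
For `z` outside `[-1, 1]` the number `(z + 1) / (z - 1)` is not in `(-∞, 0]`, so that the principal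
power is `exp ((μ / 2) (log (z + 1) - log (z - 1)))`. -/
def legendreP (n : ℕ) (μ z : ℂ) : ℂ :=
  ((z + 1) / (z - 1)) ^ (μ / 2) *
    Complex.regularizedGaussHGFun (-(n : ℂ)) ((n : ℂ) + 1) (1 - μ) ((1 - z) / 2)

/-- The expression `(π / 2) (e^{iπμ} / sin (πμ)) [P_n^μ(z) - (-1)^n P_n^μ(-z)]` which defines
`Q_n^μ(z)` at the orders `μ` that are not integers. -/
def legendreQAux (n : ℕ) (z μ : ℂ) : ℂ :=
  (Real.pi : ℂ) / 2 * (Complex.exp (Complex.I * Real.pi * μ) / Complex.sin (Real.pi * μ)) *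
    (legendreP n μ z - (-1) ^ n * legendreP n μ (-z))

/-- The associated Legendre function of the second kind `Q_n^μ(z)` off the cut (Hobson); at integer
orders it is the limiting value of the defining expression. -/
def legendreQ (n : ℕ) (μ z : ℂ) : ℂ :=
  limUnder (𝓝[≠] μ) (legendreQAux n z)

/-- `U_n^m(z)`, defined by
`∂P_n^μ(z)/∂μ |_{μ = m} = ½ P_n^m(z) ln ((z + 1) / (z - 1)) + U_n^m(z)`. -/
def legendreU (n m : ℕ) (z : ℂ) : ℂ :=
  deriv (fun μ : ℂ => legendreP n μ z) m
    - 1 / 2 * legendreP n m z * Complex.log ((z + 1) / (z - 1))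

/-- `W_{n-1}^m(z) = ½ [(-1)^n U_n^m(-z) - U_n^m(z)]`; `legendreW n m` is `W_{n-1}^m`. -/
def legendreW (n m : ℕ) (z : ℂ) : ℂ :=
  1 / 2 * ((-1) ^ n * legendreU n m (-z) - legendreU n m z)

/-- The one-sided neighbourhoods of the real point `x` in the upper half-plane. -/
def nhdsAbove (x : ℝ) : Filter ℂ := 𝓝[{z : ℂ | 0 < z.im}] (x : ℂ)

/-- The one-sided neighbourhoods of the real point `x` in the lower half-plane. -/
def nhdsBelow (x : ℝ) : Filter ℂ := 𝓝[{z : ℂ | z.im < 0}] (x : ℂ)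

/-- The boundary value `f(x + i0)`. -/
def valueAbove (f : ℂ → ℂ) (x : ℝ) : ℂ := limUnder (nhdsAbove x) f

/-- The boundary value `f(x - i0)`. -/
def valueBelow (f : ℂ → ℂ) (x : ℝ) : ℂ := limUnder (nhdsBelow x) f

/-- Both boundary values `f(x + i0)` and `f(x - i0)` exist (as finite limits). -/
def HasBoundaryValues (f : ℂ → ℂ) (x : ℝ) : Prop :=
  (∃ a : ℂ, Tendsto f (nhdsAbove x) (𝓝 a)) ∧ (∃ b : ℂ, Tendsto f (nhdsBelow x) (𝓝 b))

/-- The Legendre function of the first kind on the cut,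
`P_n^μ(x) = ½ [e^{iπμ/2} P_n^μ(x + i0) + e^{-iπμ/2} P_n^μ(x - i0)]`. -/
def ferrersP (n : ℕ) (μ : ℂ) (x : ℝ) : ℂ :=
  1 / 2 * (Complex.exp (Complex.I * Real.pi * μ / 2) * valueAbove (legendreP n μ) x
    + Complex.exp (-(Complex.I * Real.pi * μ / 2)) * valueBelow (legendreP n μ) x)

/-- The Legendre function of the second kind on the cut,
`Q_n^μ(x) = ½ e^{-iπμ} [e^{-iπμ/2} Q_n^μ(x + i0) + e^{iπμ/2} Q_n^μ(x - i0)]`. -/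
def ferrersQ (n : ℕ) (μ : ℂ) (x : ℝ) : ℂ :=
  1 / 2 * Complex.exp (-(Complex.I * Real.pi * μ)) *
    (Complex.exp (-(Complex.I * Real.pi * μ / 2)) * valueAbove (legendreQ n μ) x
      + Complex.exp (Complex.I * Real.pi * μ / 2) * valueBelow (legendreQ n μ) x)

/-- `W_{n-1}^m(x) = ½ (-1)^m [e^{-iπm/2} W_{n-1}^m(x + i0) + e^{iπm/2} W_{n-1}^m(x - i0)]`. -/
def ferrersW (n m : ℕ) (x : ℝ) : ℂ :=
  (-1) ^ m / 2 *
    (Complex.exp (-(Complex.I * Real.pi * m / 2)) * valueAbove (legendreW n m) x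
      + Complex.exp (Complex.I * Real.pi * m / 2) * valueBelow (legendreW n m) x)

end

/-! With `w = (1 - z) / 2`, the regularized hypergeometric function is a polynomial `jacobiPoly n μ`
in `w` times `1 / Γ(n + 1 - μ)`. An order derivative of `P_n^μ` therefore has three parts, falling
on the power, on the polynomial and on the Gamma factor. The first is the logarithm removed in `U`.
The third is a multiple of `P_n^m` itself and drops out of `W`, because `P_n^m(-z) = (-1)^n
P_n^m(z)` for `m ≤ n`. Hence `W` involves only the order derivative of the polynomial.

The heart of the proof is `deriv_jacobiCoeff`, which expands that derivative in the polynomials of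
lower degree and the same order. Differentiating the hypergeometric equation in `μ` gives an
equation with source `d/dw` of the polynomial. The source is the difference of two sums over lower
degrees, and the eigenvalue gaps `n(n+1) - k(k+1)` divide it termwise.

L'Hôpital's rule at `μ = m` gives `Q` in terms of `P` and `W` off the cut (`tendsto_legendreQAux`).
On the cut the logarithm tends to its real part `∓ πi`; the prescribed phases combine so that the
`πi` terms cancel. In the resulting sum for `W`, degrees `k < m` give functions of order `-m` at
`±x`; for `k ≥ m` reflection merges the two values and removes every `k` with `n - k` even. -/

noncomputable section

/-! ### Coefficients of the polynomials and their recursions. -/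

/-- The coefficient `(-n)_j (n+1)_j / j!`. -/
def legendreCoeff (n j : ℕ) : ℂ :=
  (ascPochhammer ℂ j).eval (-(n : ℂ)) * (ascPochhammer ℂ j).eval ((n : ℂ) + 1) / (j ! : ℂ)

/-- The product `(j + 1 - μ) ⋯ (n - μ)`. -/
def shiftedRising (n j : ℕ) (μ : ℂ) : ℂ :=
  (ascPochhammer ℂ (n - j)).eval (1 - μ + j)

/-- The coefficient of `X ^ j` in the polynomial `jacobiPoly n μ`. -/
def jacobiCoeff (n j : ℕ) (μ : ℂ) : ℂ := legendreCoeff n j * shiftedRising n j μ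

theorem legendreCoeff_eq_zero {n j : ℕ} (h : n < j) : legendreCoeff n j = 0 := by
  simp [legendreCoeff, ascPochhammer_eval_neg_coe_nat_of_lt h]

theorem ascPochhammer_eval_succ_left (k : ℕ) (s : ℂ) :
    (ascPochhammer ℂ (k + 1)).eval s = s * (ascPochhammer ℂ k).eval (s + 1) := by
  simp [ascPochhammer_succ_left, Polynomial.eval_comp]

theorem ascPochhammer_eval_shift (k : ℕ) (s : ℂ) :
    s * (ascPochhammer ℂ k).eval (s + 1) = (ascPochhammer ℂ k).eval s * (s + k) := by
  rw [← ascPochhammer_eval_succ_left, ascPochhammer_succ_eval]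

theorem legendreCoeff_succ_right (n j : ℕ) :
    ((j : ℂ) + 1) * legendreCoeff n (j + 1) =
      -(((n : ℂ) + j + 1) * ((n : ℂ) - j)) * legendreCoeff n j := by
  have h : ((j : ℂ) + 1) ≠ 0 := Nat.cast_add_one_ne_zero j
  have h2 : (j ! : ℂ) ≠ 0 := by exact_mod_cast Nat.factorial_ne_zero j
  simp only [legendreCoeff, ascPochhammer_succ_eval, Nat.factorial_succ]
  push_cast
  field_simp
  ring

theorem legendreCoeff_succ_left (n j : ℕ) :
    ((n : ℂ) + 1 - j) * legendreCoeff (n + 1) j = ((n : ℂ) + 1 + j) * legendreCoeff n j := by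
  have h : ((n : ℂ) + 1) ≠ 0 := Nat.cast_add_one_ne_zero n
  have h1 := ascPochhammer_eval_shift j (-((n : ℂ) + 1))
  have h2 := ascPochhammer_eval_shift j ((n : ℂ) + 1)
  rw [show -((n : ℂ) + 1) + 1 = -n by ring] at h1
  simp only [legendreCoeff]
  push_cast
  have h3 : (ascPochhammer ℂ j).eval ((n : ℂ) + 1 + 1)
      = (ascPochhammer ℂ j).eval ((n : ℂ) + 1) * ((n : ℂ) + 1 + j) / ((n : ℂ) + 1) := by
    rw [eq_div_iff h, ← h2]; ring
  rw [h3]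
  have h4 : (j ! : ℂ) ≠ 0 := by exact_mod_cast Nat.factorial_ne_zero j
  field_simp
  linear_combination ((ascPochhammer ℂ j).eval ((n : ℂ) + 1) * ((n : ℂ) + 1 + j)) * h1

theorem shiftedRising_self (n : ℕ) (μ : ℂ) : shiftedRising n n μ = 1 := by
  simp [shiftedRising]

theorem shiftedRising_succ_left {n j : ℕ} (h : j ≤ n) (μ : ℂ) :
    shiftedRising (n + 1) j μ = ((n : ℂ) + 1 - μ) * shiftedRising n j μ := by
  rw [shiftedRising, shiftedRising, Nat.sub_add_comm h, ascPochhammer_succ_eval, Nat.cast_sub h]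
  ring

theorem shiftedRising_of_lt {n j : ℕ} (h : j < n) (μ : ℂ) :
    shiftedRising n j μ = ((j : ℂ) + 1 - μ) * shiftedRising n (j + 1) μ := by
  rw [shiftedRising, shiftedRising, show n - j = n - (j + 1) + 1 by omega,
    ascPochhammer_eval_succ_left]
  push_cast
  ring_nf

theorem jacobiCoeff_eq_zero {n j : ℕ} (h : n < j) (μ : ℂ) : jacobiCoeff n j μ = 0 := by
  simp [jacobiCoeff, legendreCoeff_eq_zero h]

theorem jacobiCoeff_succ_left (n j : ℕ) (μ : ℂ) :
    ((n : ℂ) + 1 - j) * jacobiCoeff (n + 1) j μ =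
      ((n : ℂ) + 1 - μ) * ((n : ℂ) + 1 + j) * jacobiCoeff n j μ := by
  rcases le_or_gt j n with h | h
  · simp only [jacobiCoeff, shiftedRising_succ_left h]
    linear_combination ((n : ℂ) + 1 - μ) * shiftedRising n j μ * legendreCoeff_succ_left n j
  · rw [jacobiCoeff_eq_zero h]
    rcases Nat.lt_or_ge (n + 1) j with h' | h'
    · rw [jacobiCoeff_eq_zero h']; ring
    · obtain rfl : j = n + 1 := by omega
      push_cast; ring

/-- The hypergeometric equation `w(1-w)P'' + (1-μ-2w)P' + n(n+1)P = 0`, read off at `w ^ j`. -/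
theorem jacobiCoeff_succ_right (n j : ℕ) (μ : ℂ) :
    ((j : ℂ) + 1) * ((j : ℂ) + 1 - μ) * jacobiCoeff n (j + 1) μ
      + ((n : ℂ) * (n + 1) - j * (j + 1)) * jacobiCoeff n j μ = 0 := by
  rcases lt_trichotomy j n with h | rfl | h
  · simp only [jacobiCoeff, shiftedRising_of_lt h]
    linear_combination ((j : ℂ) + 1 - μ) * shiftedRising n (j + 1) μ * legendreCoeff_succ_right n j
  · rw [jacobiCoeff_eq_zero (Nat.lt_succ_self _)]; ring
  · rw [jacobiCoeff_eq_zero h, jacobiCoeff_eq_zero (Nat.lt_succ_of_lt h)]; ring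

/-- Mirror image of `jacobiCoeff_succ_left` under `w ↦ 1 - w`, `μ ↦ -μ`; the pair yields both the
expansion sums and the reflection formula. -/
theorem jacobiCoeff_succ_left' (n j : ℕ) (μ : ℂ) :
    ((n : ℂ) + 1 - j) * jacobiCoeff (n + 1) j μ + ((j : ℂ) + 1) * jacobiCoeff (n + 1) (j + 1) μ =
      -((n : ℂ) + 1 + μ) * (((n : ℂ) + 1 + j) * jacobiCoeff n j μ
        - ((j : ℂ) + 1) * jacobiCoeff n (j + 1) μ) := by
  have e := legendreCoeff_succ_left n j
  have f := legendreCoeff_succ_right (n + 1) j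
  have g := legendreCoeff_succ_right n j
  push_cast at f
  rcases lt_trichotomy j n with h | rfl | h
  · simp only [jacobiCoeff, shiftedRising_succ_left h.le, shiftedRising_succ_left h,
      shiftedRising_of_lt h]
    set R := shiftedRising n (j + 1) μ
    linear_combination ((n : ℂ) + 1 - μ) * R * ((j : ℂ) + 1 - μ - ((n : ℂ) + 1 + j + 1)) * e
      + ((n : ℂ) + 1 - μ) * R * f - ((n : ℂ) + 1 + μ) * R * g
  · simp only [jacobiCoeff, shiftedRising_succ_left le_rfl, shiftedRising_self,
      legendreCoeff_eq_zero (Nat.lt_succ_self _)]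
    linear_combination ((j : ℂ) + 1 - μ - ((j : ℂ) + 1 + j + 1)) * e + f
  · rw [jacobiCoeff_eq_zero h, jacobiCoeff_eq_zero (Nat.lt_succ_of_lt h),
      jacobiCoeff_eq_zero (Nat.succ_lt_succ h)]
    rcases Nat.lt_or_ge (n + 1) j with h' | h'
    · rw [jacobiCoeff_eq_zero h']; ring
    · obtain rfl : j = n + 1 := by omega
      push_cast; ring

/-! ### Expansion of the order derivative in lower degrees. -/

/-- Raising `n` multiplies all old weights by the common factor `-(n + 1 - μ)` and adds one term, so
the induction step is the ladder relation. The right side represents `w d/dw - n`; in the companion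
sum below it is `(w - 1) d/dw - n`. -/
theorem sum_alternating_shiftedRising_mul_jacobiCoeff (n j : ℕ) (μ : ℂ) :
    ∑ k ∈ Finset.range n, (2 * (k : ℂ) + 1) * ((-1) ^ (n - k) * shiftedRising n k μ)
      * jacobiCoeff k j μ = ((j : ℂ) - n) * jacobiCoeff n j μ := by
  induction n with
  | zero =>
    rcases Nat.eq_zero_or_pos j with rfl | h
    · simp
    · simp [jacobiCoeff_eq_zero h]
  | succ n ih =>
    have h : ∀ k ∈ Finset.range n, (2 * (k : ℂ) + 1) * ((-1) ^ (n + 1 - k)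
        * shiftedRising (n + 1) k μ) * jacobiCoeff k j μ = -((n : ℂ) + 1 - μ) *
        ((2 * (k : ℂ) + 1) * ((-1) ^ (n - k) * shiftedRising n k μ) * jacobiCoeff k j μ) := by
      intro k hk
      have hk' := (Finset.mem_range.1 hk).le
      rw [shiftedRising_succ_left hk', Nat.sub_add_comm hk', pow_succ]
      ring
    rw [Finset.sum_range_succ, Finset.sum_congr rfl h, ← Finset.mul_sum, ih,
      shiftedRising_succ_left le_rfl, shiftedRising_self, Nat.sub_add_comm le_rfl]
    push_cast
    simp only [Nat.sub_self, zero_add, pow_one]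
    linear_combination jacobiCoeff_succ_left n j μ

theorem sum_shiftedRising_neg_mul_jacobiCoeff (n j : ℕ) (μ : ℂ) :
    ∑ k ∈ Finset.range n, (2 * (k : ℂ) + 1) * shiftedRising n k (-μ) * jacobiCoeff k j μ
      = ((j : ℂ) - n) * jacobiCoeff n j μ - ((j : ℂ) + 1) * jacobiCoeff n (j + 1) μ := by
  induction n with
  | zero =>
    rw [jacobiCoeff_eq_zero (Nat.succ_pos j)]
    rcases Nat.eq_zero_or_pos j with rfl | h
    · simp
    · simp [jacobiCoeff_eq_zero h]
  | succ n ih =>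
    have h : ∀ k ∈ Finset.range n, (2 * (k : ℂ) + 1) * shiftedRising (n + 1) k (-μ)
        * jacobiCoeff k j μ = ((n : ℂ) + 1 + μ) *
        ((2 * (k : ℂ) + 1) * shiftedRising n k (-μ) * jacobiCoeff k j μ) := by
      intro k hk
      rw [shiftedRising_succ_left (Finset.mem_range.1 hk).le]
      ring
    rw [Finset.sum_range_succ, Finset.sum_congr rfl h, ← Finset.mul_sum, ih,
      shiftedRising_succ_left le_rfl, shiftedRising_self]
    push_cast
    linear_combination jacobiCoeff_succ_left' n j μ

/-- The coefficients in the expansion of `∂/∂μ` of `jacobiPoly n μ` in the `jacobiPoly k μ`. -/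
def orderDerivCoeff (n k : ℕ) (μ : ℂ) : ℂ :=
  (2 * (k : ℂ) + 1) / (((n : ℂ) - k) * ((k : ℂ) + n + 1)) *
    ((-1) ^ (n - k) * shiftedRising n k μ - shiftedRising n k (-μ))

/-- The difference of the two preceding sums leaves exactly `d/dw`. The weight equals `(n - k)(k + n
+ 1)` and cancels the denominator of `orderDerivCoeff`. -/
theorem sum_orderDerivCoeff_mul_jacobiCoeff (n j : ℕ) (μ : ℂ) :
    ∑ k ∈ Finset.range n, ((n : ℂ) * (n + 1) - k * (k + 1)) *
      (orderDerivCoeff n k μ * jacobiCoeff k j μ) = ((j : ℂ) + 1) * jacobiCoeff n (j + 1) μ := by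
  have h := congrArg₂ (· - ·) (sum_alternating_shiftedRising_mul_jacobiCoeff n j μ)
    (sum_shiftedRising_neg_mul_jacobiCoeff n j μ)
  simp only [← Finset.sum_sub_distrib] at h
  calc _ = _ := Finset.sum_congr rfl fun k hk => ?_
    _ = _ := h
    _ = _ := by ring
  have hk' := Finset.mem_range.1 hk
  have h1 : (n : ℂ) - k ≠ 0 := by
    rw [sub_ne_zero]; exact_mod_cast hk'.ne'
  have h2 : (k : ℂ) + n + 1 ≠ 0 := by exact_mod_cast Nat.succ_ne_zero (k + n)
  rw [orderDerivCoeff]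
  field_simp
  ring

theorem differentiable_jacobiCoeff (n j : ℕ) : Differentiable ℂ (jacobiCoeff n j) := by
  unfold jacobiCoeff shiftedRising
  exact (((ascPochhammer ℂ (n - j)).differentiable.comp
    ((differentiable_id.const_sub 1).add_const (j : ℂ))).const_mul _)

theorem deriv_jacobiCoeff_succ_right (n j : ℕ) (μ : ℂ) :
    ((j : ℂ) + 1) * ((j : ℂ) + 1 - μ) * deriv (jacobiCoeff n (j + 1)) μ
      + ((n : ℂ) * (n + 1) - j * (j + 1)) * deriv (jacobiCoeff n j) μ
      = ((j : ℂ) + 1) * jacobiCoeff n (j + 1) μ := by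
  have h1 := (differentiable_jacobiCoeff n (j + 1) μ).hasDerivAt
  have h2 := (differentiable_jacobiCoeff n j μ).hasDerivAt
  have h3 := ((((hasDerivAt_id μ).const_sub ((j : ℂ) + 1)).const_mul ((j : ℂ) + 1)).mul h1).add
    (h2.const_mul ((n : ℂ) * (n + 1) - j * (j + 1)))
  have h4 := h3.unique ((hasDerivAt_const μ (0 : ℂ)).congr_of_eventuallyEq
    (Eventually.of_forall fun ν => jacobiCoeff_succ_right n j ν))
  simp only [id] at h4
  linear_combination h4

/-- Both sides satisfy the same inhomogeneous recursion in `j`. They vanish for `j ≥ n`, the leading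
coefficient being independent of `μ`, and the recursion can be solved downwards. -/
theorem deriv_jacobiCoeff (n j : ℕ) (μ : ℂ) :
    deriv (jacobiCoeff n j) μ =
      ∑ k ∈ Finset.range n, orderDerivCoeff n k μ * jacobiCoeff k j μ := by
  have base : ∀ i, n ≤ i → deriv (jacobiCoeff n i) μ =
      ∑ k ∈ Finset.range n, orderDerivCoeff n k μ * jacobiCoeff k i μ := by
    intro i h
    rw [Finset.sum_eq_zero fun k hk => by
      rw [jacobiCoeff_eq_zero ((Finset.mem_range.1 hk).trans_le h), mul_zero]]
    have : jacobiCoeff n i = fun _ => legendreCoeff n i := by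
      funext ν
      rw [jacobiCoeff, shiftedRising, Nat.sub_eq_zero_of_le h]; simp
    rw [this, deriv_const]
  rcases le_or_gt n j with h | h
  · exact base j h
  induction h.le using Nat.decreasingInduction with
  | self => exact base n le_rfl
  | of_succ i hi ih =>
    have ih' : deriv (jacobiCoeff n (i + 1)) μ =
        ∑ k ∈ Finset.range n, orderDerivCoeff n k μ * jacobiCoeff k (i + 1) μ := by
      rcases le_or_gt n (i + 1) with h' | h'
      · exact base _ h'
      · exact ih h'
    have h1 := deriv_jacobiCoeff_succ_right n i μ
    have h2 := sum_orderDerivCoeff_mul_jacobiCoeff n i μ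
    -- This factor multiplies the coefficient of index `i`; it is nonzero because `i < n`, so index
    -- `i + 1` determines index `i`.
    have h3 : (n : ℂ) * (n + 1) - i * (i + 1) ≠ 0 := by
      have e : (n : ℂ) * (n + 1) - i * (i + 1) = ((n : ℂ) - i) * ((n + i + 1 : ℕ) : ℂ) := by
        push_cast; ring
      rw [e]
      exact mul_ne_zero (sub_ne_zero.2 (by exact_mod_cast hi.ne'))
        (Nat.cast_ne_zero.2 (Nat.succ_ne_zero _))
    apply mul_left_cancel₀ h3
    rw [eq_sub_of_add_eq' h1, ih', ← h2, Finset.mul_sum, Finset.mul_sum, ← Finset.sum_sub_distrib]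
    refine Finset.sum_congr rfl fun k _ => ?_
    linear_combination -orderDerivCoeff n k μ * jacobiCoeff_succ_right k i μ

/-! ### The polynomials, their ladder relations and reflection. -/

/-- The polynomial `n! P_n^{(-μ, μ)}(1 - 2 X)`, a multiple of a Jacobi polynomial. -/
def jacobiPoly (n : ℕ) (μ : ℂ) : Polynomial ℂ :=
  ∑ j ∈ Finset.range (n + 1), Polynomial.monomial j (jacobiCoeff n j μ)

theorem coeff_jacobiPoly (n j : ℕ) (μ : ℂ) : (jacobiPoly n μ).coeff j = jacobiCoeff n j μ := by
  rw [jacobiPoly, Polynomial.finsetSum_coeff]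
  simp only [Polynomial.coeff_monomial, Finset.sum_ite_eq', Finset.mem_range]
  split_ifs with h
  · rfl
  · rw [jacobiCoeff_eq_zero (by omega)]

theorem eval_jacobiPoly (n : ℕ) (μ w : ℂ) :
    (jacobiPoly n μ).eval w = ∑ j ∈ Finset.range (n + 1), jacobiCoeff n j μ * w ^ j := by
  simp [jacobiPoly, Polynomial.eval_finsetSum]

theorem eval_jacobiPoly_of_le {n N : ℕ} (h : n ≤ N) (μ w : ℂ) :
    (jacobiPoly n μ).eval w = ∑ j ∈ Finset.range (N + 1), jacobiCoeff n j μ * w ^ j := by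
  rw [eval_jacobiPoly]
  refine Finset.sum_subset (Finset.range_mono (by omega)) fun j _ hj => ?_
  rw [jacobiCoeff_eq_zero (by simpa using hj), zero_mul]

theorem hasDerivAt_jacobiPoly (n : ℕ) (μ w : ℂ) :
    HasDerivAt (fun ν => (jacobiPoly n ν).eval w)
      (∑ k ∈ Finset.range n, orderDerivCoeff n k μ * (jacobiPoly k μ).eval w) μ := by
  have h : HasDerivAt (fun ν => ∑ j ∈ Finset.range (n + 1), jacobiCoeff n j ν * w ^ j)
      (∑ j ∈ Finset.range (n + 1), deriv (jacobiCoeff n j) μ * w ^ j) μ :=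
    HasDerivAt.fun_sum fun j _ =>
      ((differentiable_jacobiCoeff n j μ).hasDerivAt.mul_const (w ^ j))
  simp only [eval_jacobiPoly n]
  convert h using 1
  simp only [deriv_jacobiCoeff, Finset.sum_mul]
  rw [Finset.sum_comm]
  refine Finset.sum_congr rfl fun k hk => ?_
  rw [eval_jacobiPoly_of_le (Finset.mem_range.1 hk).le, Finset.mul_sum]
  exact Finset.sum_congr rfl fun j _ => by ring

open Polynomial in
theorem coeff_X_mul_derivative (p : ℂ[X]) (j : ℕ) :
    (X * derivative p).coeff j = j * p.coeff j := by
  cases j with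
  | zero => simp
  | succ j => rw [coeff_X_mul, coeff_derivative]; push_cast; ring

open Polynomial in
theorem jacobiPoly_succ (n : ℕ) (μ : ℂ) :
    X * derivative (jacobiPoly (n + 1) μ) - C ((n : ℂ) + 1) * jacobiPoly (n + 1) μ =
      -C ((n : ℂ) + 1 - μ) * (X * derivative (jacobiPoly n μ)
        + C ((n : ℂ) + 1) * jacobiPoly n μ) := by
  ext j
  rw [← C_neg]
  simp only [coeff_sub, coeff_add, coeff_C_mul, coeff_X_mul_derivative, coeff_jacobiPoly]
  linear_combination -jacobiCoeff_succ_left n j μ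

open Polynomial in
theorem jacobiPoly_succ' (n : ℕ) (μ : ℂ) :
    -C ((n : ℂ) + 1) * jacobiPoly (n + 1) μ - (1 - X) * derivative (jacobiPoly (n + 1) μ) =
      C ((n : ℂ) + 1 + μ) * (C ((n : ℂ) + 1) * jacobiPoly n μ
        - (1 - X) * derivative (jacobiPoly n μ)) := by
  ext j
  rw [← C_neg]
  simp only [sub_mul, one_mul, coeff_sub, coeff_C_mul, coeff_X_mul_derivative, coeff_derivative,
    coeff_jacobiPoly]
  linear_combination -jacobiCoeff_succ_left' n j μ

open Polynomial in
-- The substitution `X ↦ 1 - X`, `μ ↦ -μ` exchanges the two ladder relations, up to sign.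
theorem jacobiPoly_comp_one_sub_X (n : ℕ) (μ : ℂ) :
    (jacobiPoly n (-μ)).comp (1 - X) = (-1) ^ n * jacobiPoly n μ := by
  induction n with
  | zero =>
    simp [jacobiPoly, jacobiCoeff, legendreCoeff, shiftedRising]
  | succ n ih =>
    have e1 := congrArg (fun p => p.comp (1 - X)) (jacobiPoly_succ n (-μ))
    have e2 := congrArg (fun p => p.comp (1 - X)) (jacobiPoly_succ' n (-μ))
    have d := congrArg derivative ih
    have f1 := jacobiPoly_succ n μ
    have f2 := jacobiPoly_succ' n μ
    rw [derivative_comp_one_sub_X] at d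
    have d' : derivative ((-1 : ℂ[X]) ^ n * jacobiPoly n μ)
        = (-1) ^ n * derivative (jacobiPoly n μ) := by
      rw [show ((-1 : ℂ[X]) ^ n) = C ((-1) ^ n) by simp, derivative_C_mul]
    rw [d'] at d
    simp only [sub_comp, mul_comp, add_comp, neg_comp, X_comp, C_comp, one_comp, ih] at e1 e2
    have hC : C ((n : ℂ) + 1) ≠ 0 := C_ne_zero.2 (Nat.cast_add_one_ne_zero n)
    apply mul_left_cancel₀ hC
    simp only [C_add, C_sub, C_neg] at *
    generalize (derivative (jacobiPoly n (-μ))).comp (1 - X) = D at *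
    obtain rfl : D = -((-1) ^ n * derivative (jacobiPoly n μ)) := by linear_combination -d
    -- The weights `X` and `1 - X` eliminate the derivative of the degree `n + 1` polynomial from
    -- each pair.
    linear_combination -X * e1 - (1 - X) * e2 - (-1) ^ n * ((1 - X) * f1 + X * f2)

/-! ### Integer orders. -/

theorem shiftedRising_natCast_of_lt {m n k : ℕ} (hk : k < m) (hmn : m ≤ n) :
    shiftedRising n k (m : ℂ) = 0 := by
  rw [shiftedRising, ascPochhammer_eval_eq_zero_iff]
  refine ⟨m - 1 - k, by omega, ?_⟩
  rw [Nat.cast_sub (by omega), Nat.cast_sub (by omega)]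
  push_cast; ring

theorem shiftedRising_natCast_of_le {m n k : ℕ} (hk : m ≤ k) (hkn : k ≤ n) :
    shiftedRising n k (m : ℂ) = ((n - m)! : ℂ) / ((k - m)! : ℂ) := by
  have h : ((k - m)! : ℂ) ≠ 0 := by exact_mod_cast Nat.factorial_ne_zero _
  rw [shiftedRising, eq_div_iff h, show (1 - (m : ℂ) + k) = ((k - m : ℕ) : ℂ) + 1 by
    rw [Nat.cast_sub hk]; ring]
  have := Nat.factorial_mul_ascFactorial (k - m) (n - k)
  rw [show k - m + (n - k) = n - m by omega] at this
  rw [← this, show ((k - m : ℕ) : ℂ) + 1 = ((k - m + 1 : ℕ) : ℂ) by push_cast; ring,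
    ← ascPochhammer_eval_cast, ascPochhammer_nat_eq_ascFactorial]
  push_cast; ring

theorem shiftedRising_neg_natCast {n k : ℕ} (m : ℕ) (hkn : k ≤ n) :
    shiftedRising n k (-(m : ℂ)) = ((n + m)! : ℂ) / ((k + m)! : ℂ) := by
  have h : ((k + m)! : ℂ) ≠ 0 := by exact_mod_cast Nat.factorial_ne_zero _
  rw [shiftedRising, eq_div_iff h]
  have := Nat.factorial_mul_ascFactorial (k + m) (n - k)
  rw [show k + m + (n - k) = n + m by omega] at this
  rw [← this, show (1 - -(m : ℂ) + k) = ((k + m + 1 : ℕ) : ℂ) by push_cast; ring,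
    ← ascPochhammer_eval_cast, ascPochhammer_nat_eq_ascFactorial]
  push_cast; ring

open Polynomial in
-- Coefficients below `m` vanish through a zero factor of `shiftedRising`. This Rodrigues-like form
-- transfers the parity of the order zero polynomial to order `m`.
theorem jacobiPoly_natCast {n m : ℕ} (hmn : m ≤ n) :
    jacobiPoly n (m : ℂ) = C (((n - m)! : ℂ) / (n ! : ℂ)) *
      (X ^ m * derivative^[m] (jacobiPoly n 0)) := by
  ext j
  rw [coeff_C_mul, coeff_X_pow_mul', coeff_jacobiPoly]
  split_ifs with h
  · rw [coeff_iterate_derivative, coeff_jacobiPoly, Nat.sub_add_cancel h]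
    rcases lt_or_ge n j with h' | h'
    · simp [jacobiCoeff_eq_zero h']
    · have e := shiftedRising_natCast_of_le (Nat.zero_le j) h'
      have h1 : ((j - m)! : ℂ) ≠ 0 := by exact_mod_cast Nat.factorial_ne_zero _
      have h2 : (j ! : ℂ) ≠ 0 := by exact_mod_cast Nat.factorial_ne_zero _
      have h3 : (n ! : ℂ) ≠ 0 := by exact_mod_cast Nat.factorial_ne_zero _
      have h4 : ((j.descFactorial m : ℕ) : ℂ) = (j ! : ℂ) / ((j - m)! : ℂ) := by
        rw [eq_div_iff h1, ← Nat.factorial_mul_descFactorial h]; push_cast; ring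
      simp only [Nat.cast_zero, Nat.sub_zero] at e
      rw [jacobiCoeff, jacobiCoeff, e, shiftedRising_natCast_of_le h h', nsmul_eq_mul, h4]
      field_simp
  · rw [jacobiCoeff, shiftedRising_natCast_of_lt (not_le.1 h) hmn]; simp

/-- The reflection formula for the order `m`: this is `P_n^m(-z) = (-1)^n P_n^m(z)` without the
powers of `(z + 1) / (z - 1)`. -/
theorem jacobiPoly_natCast_eval_one_sub {n m : ℕ} (hmn : m ≤ n) (w : ℂ) :
    w ^ m * (jacobiPoly n (m : ℂ)).eval (1 - w) =
      (-1) ^ (n + m) * ((1 - w) ^ m * (jacobiPoly n (m : ℂ)).eval w) := by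
  have h := jacobiPoly_comp_one_sub_X n 0
  rw [neg_zero] at h
  have h2 := Polynomial.iterate_derivative_comp_one_sub_X (jacobiPoly n 0) m
  rw [h, show ((-1 : Polynomial ℂ) ^ n) = Polynomial.C ((-1) ^ n) by simp,
    Polynomial.iterate_derivative_C_mul] at h2
  have h3 := congrArg (Polynomial.eval w) h2
  simp only [Polynomial.eval_mul, Polynomial.eval_comp, Polynomial.eval_sub, Polynomial.eval_pow,
    Polynomial.eval_neg, Polynomial.eval_C, Polynomial.eval_one, Polynomial.eval_X] at h3
  rw [jacobiPoly_natCast hmn]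
  simp only [Polynomial.eval_mul, Polynomial.eval_pow, Polynomial.eval_C, Polynomial.eval_X]
  have h4 : ((-1 : ℂ) ^ m) * (-1) ^ m = 1 := by rw [← mul_pow]; simp
  rw [pow_add]
  generalize (Polynomial.derivative^[m] (jacobiPoly n 0)).eval (1 - w) = a at *
  generalize (Polynomial.derivative^[m] (jacobiPoly n 0)).eval w = b at *
  generalize (n - m)! / (n ! : ℂ) = c
  linear_combination (-w ^ m * c * (1 - w) ^ m * a) * h4
    - (w ^ m * c * (1 - w) ^ m * (-1) ^ m) * h3

theorem jacobiPoly_neg_eval_one_sub (n : ℕ) (μ w : ℂ) :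
    (jacobiPoly n (-μ)).eval (1 - w) = (-1) ^ n * (jacobiPoly n μ).eval w := by
  have h := congrArg (Polynomial.eval w) (jacobiPoly_comp_one_sub_X n μ)
  simpa [Polynomial.eval_comp] using h

/-! ### Legendre functions off the cut. -/

theorem ascPochhammer_eval_mul_inv_Gamma (k : ℕ) (s : ℂ) :
    (ascPochhammer ℂ k).eval s * (Complex.Gamma (s + k))⁻¹ = (Complex.Gamma s)⁻¹ := by
  induction k with
  | zero => simp
  | succ k ih =>
    rw [← ih, ascPochhammer_succ_eval, Complex.one_div_Gamma_eq_self_mul_one_div_Gamma_add_one (s + k)]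
    push_cast
    rw [← add_assoc]
    ring

theorem shiftedRising_mul_inv_Gamma {n j : ℕ} (h : j ≤ n) (μ : ℂ) :
    shiftedRising n j μ * (Complex.Gamma ((n : ℂ) + 1 - μ))⁻¹
      = (Complex.Gamma (1 - μ + j))⁻¹ := by
  rw [← ascPochhammer_eval_mul_inv_Gamma (n - j) (1 - μ + j), shiftedRising, Nat.cast_sub h]
  congr 3
  ring

/-- The factor `(-n)_j` ends the series at `j = n`, and `shiftedRising` brings every `1 / Γ(1 - μ +
j)` to the single factor `1 / Γ(n + 1 - μ)`. No order is exceptional. -/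
theorem regularizedGaussHGFun_eq_jacobiPoly (n : ℕ) (μ w : ℂ) :
    Complex.regularizedGaussHGFun (-(n : ℂ)) ((n : ℂ) + 1) (1 - μ) w =
      (jacobiPoly n μ).eval w * (Complex.Gamma ((n : ℂ) + 1 - μ))⁻¹ := by
  have h : ∀ j : ℕ, (Complex.regularizedGaussHGFunSeries (-(n : ℂ)) ((n : ℂ) + 1) (1 - μ) j
      fun _ => w) = w ^ j * (legendreCoeff n j * (Complex.Gamma (1 - μ + j))⁻¹) := by
    intro j
    rw [FormalMultilinearSeries.apply_eq_pow_smul_coeff,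
      Complex.coeff_regularizedGaussHGFunSeries, legendreCoeff, smul_eq_mul]
    ring
  rw [Complex.regularizedGaussHGFun, FormalMultilinearSeries.sum, eval_jacobiPoly,
    tsum_eq_sum (s := Finset.range (n + 1)), Finset.sum_mul]
  · refine Finset.sum_congr rfl fun j hj => ?_
    rw [h, jacobiCoeff, ← shiftedRising_mul_inv_Gamma (Nat.lt_succ_iff.1 (Finset.mem_range.1 hj))]
    ring
  · intro j hj
    rw [h, legendreCoeff_eq_zero (by simpa using hj)]
    ring

/-- The logarithm `ln ((z + 1) / (z - 1))`. -/
def logRatio (z : ℂ) : ℂ := Complex.log ((z + 1) / (z - 1))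

theorem ratio_im (z : ℂ) : ((z + 1) / (z - 1)).im = -2 * z.im / Complex.normSq (z - 1) := by
  rw [Complex.div_im]
  simp only [Complex.add_im, Complex.add_re, Complex.sub_re, Complex.sub_im, Complex.one_re,
    Complex.one_im]
  ring

theorem sub_one_ne_zero_of_im_ne_zero {z : ℂ} (hz : z.im ≠ 0) : z - 1 ≠ 0 := by
  intro h; apply hz; simpa using congrArg Complex.im h

theorem add_one_ne_zero_of_im_ne_zero {z : ℂ} (hz : z.im ≠ 0) : z + 1 ≠ 0 := by
  intro h; apply hz; simpa using congrArg Complex.im h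

theorem ratio_ne_zero {z : ℂ} (hz : z.im ≠ 0) : (z + 1) / (z - 1) ≠ 0 :=
  div_ne_zero (add_one_ne_zero_of_im_ne_zero hz) (sub_one_ne_zero_of_im_ne_zero hz)

theorem ratio_im_ne_zero {z : ℂ} (hz : z.im ≠ 0) : ((z + 1) / (z - 1)).im ≠ 0 := by
  rw [ratio_im]
  exact div_ne_zero (mul_ne_zero (by norm_num) hz)
    (by simpa using sub_one_ne_zero_of_im_ne_zero hz)

theorem logRatio_neg {z : ℂ} (hz : z.im ≠ 0) : logRatio (-z) = -logRatio z := by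
  rw [logRatio, logRatio, ← Complex.log_inv, inv_div,
    show (-z + 1) / (-z - 1) = (z - 1) / (z + 1) by
      rw [← neg_div_neg_eq]; congr 1 <;> ring]
  intro h
  exact ratio_im_ne_zero hz (Complex.arg_eq_pi_iff.1 h).2

theorem legendreP_eq (n : ℕ) (μ : ℂ) {z : ℂ} (hz : z.im ≠ 0) :
    legendreP n μ z = Complex.exp (logRatio z * (μ / 2)) * (jacobiPoly n μ).eval ((1 - z) / 2)
      * (Complex.Gamma ((n : ℂ) + 1 - μ))⁻¹ := by
  rw [legendreP, Complex.cpow_def_of_ne_zero (ratio_ne_zero hz),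
    regularizedGaussHGFun_eq_jacobiPoly, logRatio, mul_assoc]

/-- The derivative of `jacobiPoly n μ` with respect to `μ` at `w`. -/
def jacobiPolyOrderDeriv (n : ℕ) (μ w : ℂ) : ℂ :=
  ∑ k ∈ Finset.range n, orderDerivCoeff n k μ * (jacobiPoly k μ).eval w

/-- The derivative of `1 / Γ(n + 1 - μ)` with respect to `μ`. -/
def invGammaOrderDeriv (n : ℕ) (μ : ℂ) : ℂ :=
  deriv (fun ν : ℂ => (Complex.Gamma ((n : ℂ) + 1 - ν))⁻¹) μ

theorem hasDerivAt_legendreP (n : ℕ) (μ : ℂ) {z : ℂ} (hz : z.im ≠ 0) :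
    HasDerivAt (fun ν => legendreP n ν z)
      (1 / 2 * legendreP n μ z * logRatio z + Complex.exp (logRatio z * (μ / 2)) *
        (jacobiPolyOrderDeriv n μ ((1 - z) / 2) * (Complex.Gamma ((n : ℂ) + 1 - μ))⁻¹
          + (jacobiPoly n μ).eval ((1 - z) / 2) * invGammaOrderDeriv n μ)) μ := by
  have hG : HasDerivAt (fun ν : ℂ => (Complex.Gamma ((n : ℂ) + 1 - ν))⁻¹)
      (invGammaOrderDeriv n μ) μ :=
    (Complex.differentiable_one_div_Gamma.comp
      (differentiable_id.const_sub ((n : ℂ) + 1)) μ).hasDerivAt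
  have hE : HasDerivAt (fun ν : ℂ => Complex.exp (logRatio z * (ν / 2)))
      (Complex.exp (logRatio z * (μ / 2)) * (logRatio z * (1 / 2))) μ :=
    (((hasDerivAt_id μ).div_const 2).const_mul (logRatio z)).cexp
  have h := (hE.mul (hasDerivAt_jacobiPoly n μ ((1 - z) / 2))).mul hG
  have h' := h.congr_of_eventuallyEq
    (Eventually.of_forall fun ν => legendreP_eq n ν hz)
  refine h'.congr_deriv ?_
  rw [legendreP_eq n μ hz, jacobiPolyOrderDeriv, Pi.mul_apply]
  ring

theorem legendreU_eq (n m : ℕ) {z : ℂ} (hz : z.im ≠ 0) :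
    legendreU n m z = Complex.exp (logRatio z * (m / 2)) *
        (jacobiPolyOrderDeriv n m ((1 - z) / 2) * (Complex.Gamma ((n : ℂ) + 1 - m))⁻¹
          + (jacobiPoly n m).eval ((1 - z) / 2) * invGammaOrderDeriv n m) := by
  rw [legendreU, (hasDerivAt_legendreP n m hz).deriv, ← logRatio]
  ring

/-- Since `(z + 1) / (z - 1) = -(1 - w) / w`, the `m`-th power of the ratio supplies the sign `(-1)
^ m` and the powers occurring in the polynomial reflection. -/
theorem exp_logRatio_mul_jacobiPoly {n m : ℕ} (hmn : m ≤ n) {z : ℂ} (hz : z.im ≠ 0) :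
    Complex.exp (-logRatio z * (m / 2)) * (jacobiPoly n (m : ℂ)).eval (1 - (1 - z) / 2) =
      (-1) ^ n * (Complex.exp (logRatio z * (m / 2)) *
        (jacobiPoly n (m : ℂ)).eval ((1 - z) / 2)) := by
  have h := jacobiPoly_natCast_eval_one_sub hmn ((1 - z) / 2)
  have hw : (1 - z) / 2 ≠ 0 := by
    intro h0; apply sub_one_ne_zero_of_im_ne_zero hz; linear_combination -2 * h0
  have e : Complex.exp (logRatio z * (m / 2)) * Complex.exp (logRatio z * (m / 2)) =
      (-(1 - (1 - z) / 2) / ((1 - z) / 2)) ^ m := by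
    rw [← Complex.exp_add, show logRatio z * (m / 2) + logRatio z * (m / 2) = m * logRatio z by ring,
      Complex.exp_nat_mul, logRatio, Complex.exp_log (ratio_ne_zero hz)]
    congr 1
    have := sub_one_ne_zero_of_im_ne_zero hz
    rw [div_eq_div_iff this hw]
    ring
  rw [neg_mul, Complex.exp_neg]
  have hE := Complex.exp_ne_zero (logRatio z * (m / 2))
  generalize Complex.exp (logRatio z * (m / 2)) = E at *
  generalize (1 - z) / 2 = w at *
  have hwm : w ^ m ≠ 0 := pow_ne_zero _ hw
  rw [div_pow, eq_div_iff hwm, neg_pow] at e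
  rw [inv_mul_eq_iff_eq_mul₀ hE]
  apply mul_left_cancel₀ hwm
  rw [h, pow_add]
  linear_combination -(-1) ^ n * (jacobiPoly n (m : ℂ)).eval w * e

theorem one_sub_neg_div_two (z : ℂ) : (1 - -z) / 2 = 1 - (1 - z) / 2 := by ring

theorem legendreP_neg {n m : ℕ} (hmn : m ≤ n) {z : ℂ} (hz : z.im ≠ 0) :
    legendreP n m (-z) = (-1) ^ n * legendreP n m z := by
  rw [legendreP_eq n m hz, legendreP_eq n m (by simpa using hz), logRatio_neg hz,
    one_sub_neg_div_two, exp_logRatio_mul_jacobiPoly hmn hz]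
  ring

theorem neg_one_pow_mul_self (n : ℕ) : (-1 : ℂ) ^ n * (-1) ^ n = 1 := by
  rw [← mul_pow]; simp

/-- Reflection makes the two contributions of `invGammaOrderDeriv` cancel. -/
theorem legendreW_eq {n m : ℕ} (hmn : m ≤ n) {z : ℂ} (hz : z.im ≠ 0) :
    legendreW n m z = 1 / 2 * (Complex.Gamma ((n : ℂ) + 1 - m))⁻¹ *
      ((-1) ^ n * (Complex.exp (-logRatio z * (m / 2)) *
          jacobiPolyOrderDeriv n m (1 - (1 - z) / 2))
        - Complex.exp (logRatio z * (m / 2)) * jacobiPolyOrderDeriv n m ((1 - z) / 2)) := by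
  rw [legendreW, legendreU_eq n m hz, legendreU_eq n m (z := -z) (by simpa using hz),
    logRatio_neg hz, one_sub_neg_div_two]
  have h := exp_logRatio_mul_jacobiPoly hmn hz
  linear_combination (1 / 2 * (-1) ^ n * invGammaOrderDeriv n m) * h
    + (1 / 2 * invGammaOrderDeriv n m * (Complex.exp (logRatio z * (m / 2)) *
        (jacobiPoly n (m : ℂ)).eval ((1 - z) / 2))) * neg_one_pow_mul_self n

/-- L'Hôpital's rule: the sine has derivative `π cos(πm)`, and `e^{iπm} = cos(πm)` cancels the
cosine. -/
theorem tendsto_exp_div_sin_mul {N : ℂ → ℂ} {N' : ℂ} {m : ℕ} (hN : HasDerivAt N N' m)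
    (hN0 : N m = 0) :
    Tendsto (fun μ : ℂ => (Real.pi : ℂ) / 2 *
      (Complex.exp (Complex.I * Real.pi * μ) / Complex.sin (Real.pi * μ)) * N μ)
      (𝓝[≠] (m : ℂ)) (𝓝 (1 / 2 * N')) := by
  have hsin : HasDerivAt (fun μ : ℂ => Complex.sin (Real.pi * μ))
      (Complex.cos (Real.pi * m) * (Real.pi * 1)) (m : ℂ) :=
    ((hasDerivAt_id (m : ℂ)).const_mul (Real.pi : ℂ)).csin
  have hs0 : Complex.sin (Real.pi * m) = 0 := by
    rw [mul_comm]; exact Complex.sin_nat_mul_pi m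
  have hc0 : Complex.cos (Real.pi * m) ≠ 0 := by
    intro hc
    have := Complex.sin_sq_add_cos_sq (Real.pi * m)
    rw [hs0, hc] at this
    norm_num at this
  have hpi : (Real.pi : ℂ) ≠ 0 := Complex.ofReal_ne_zero.2 Real.pi_ne_zero
  have hexp : Complex.exp (Complex.I * Real.pi * m) = Complex.cos (Real.pi * m) := by
    rw [show Complex.I * Real.pi * m = (Real.pi * m) * Complex.I by ring, Complex.exp_mul_I, hs0]
    ring
  have hq := (hasDerivAt_iff_tendsto_slope.1 hN).div (hasDerivAt_iff_tendsto_slope.1 hsin)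
    (mul_ne_zero hc0 (mul_ne_zero hpi one_ne_zero))
  have he : Tendsto (fun μ : ℂ => (Real.pi : ℂ) / 2 * Complex.exp (Complex.I * Real.pi * μ))
      (𝓝[≠] (m : ℂ)) (𝓝 ((Real.pi : ℂ) / 2 * Complex.exp (Complex.I * Real.pi * m))) :=
    tendsto_nhdsWithin_of_tendsto_nhds (Continuous.tendsto (by fun_prop) _)
  have ht := he.mul hq
  rw [hexp, show (Real.pi : ℂ) / 2 * Complex.cos (Real.pi * m) *
    (N' / (Complex.cos (Real.pi * m) * (Real.pi * 1))) = 1 / 2 * N' by field_simp] at ht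
  refine ht.congr' ?_
  filter_upwards [self_mem_nhdsWithin] with μ hμ
  have hμ' : μ - m ≠ 0 := sub_ne_zero.2 hμ
  simp only [Pi.div_apply, slope_def_field, hs0, hN0, sub_zero]
  rw [div_div_div_cancel_right₀ hμ']
  ring

theorem hasDerivAt_legendreP_legendreU (n m : ℕ) {z : ℂ} (hz : z.im ≠ 0) :
    HasDerivAt (fun ν => legendreP n ν z)
      (1 / 2 * legendreP n m z * logRatio z + legendreU n m z) m := by
  rw [legendreU_eq n m hz]
  exact hasDerivAt_legendreP n m hz

theorem tendsto_legendreQAux {n m : ℕ} (hmn : m ≤ n) {z : ℂ} (hz : z.im ≠ 0) :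
    Tendsto (legendreQAux n z) (𝓝[≠] (m : ℂ))
      (𝓝 (1 / 2 * legendreP n m z * logRatio z - legendreW n m z)) := by
  have hN := (hasDerivAt_legendreP_legendreU n m hz).sub
    ((hasDerivAt_legendreP_legendreU n m (z := -z) (by simpa using hz)).const_mul ((-1 : ℂ) ^ n))
  have hN0 : legendreP n m z - (-1) ^ n * legendreP n m (-z) = 0 := by
    rw [legendreP_neg hmn hz]
    linear_combination -legendreP n m z * neg_one_pow_mul_self n
  refine (tendsto_exp_div_sin_mul hN hN0).trans_eq ?_
  rw [legendreP_neg hmn hz, logRatio_neg hz, legendreW]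
  congr 1
  linear_combination (1 / 4 * legendreP n m z * logRatio z) * neg_one_pow_mul_self n

theorem legendreQ_eq {n m : ℕ} (hmn : m ≤ n) {z : ℂ} (hz : z.im ≠ 0) :
    legendreQ n m z = 1 / 2 * legendreP n m z * logRatio z - legendreW n m z :=
  (tendsto_legendreQAux hmn hz).limUnder_eq

/-! ### Boundary values on the cut. -/

/-- A filter that approaches the point `x` of the cut from outside the real line, along which the
logarithm of `(z + 1) / (z - 1)` has the limit `l`. -/
structure ApproachesCut (F : Filter ℂ) (x : ℝ) (l : ℂ) : Prop where
  neBot : F.NeBot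
  le_nhds : F ≤ 𝓝 (x : ℂ)
  im_ne_zero : ∀ᶠ z in F, z.im ≠ 0
  tendsto_logRatio : Tendsto logRatio F (𝓝 l)

/-- The boundary value of `legendreP n μ` at `x` if that of `ln ((z + 1) / (z - 1))` is `l`. -/
def boundaryP (n : ℕ) (μ : ℂ) (x : ℝ) (l : ℂ) : ℂ :=
  Complex.exp (l * (μ / 2)) * (jacobiPoly n μ).eval ((1 - (x : ℂ)) / 2)
    * (Complex.Gamma ((n : ℂ) + 1 - μ))⁻¹

/-- The boundary value of `legendreW n m` at `x` if that of `ln ((z + 1) / (z - 1))` is `l`. -/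
def boundaryW (n m : ℕ) (x : ℝ) (l : ℂ) : ℂ :=
  1 / 2 * (Complex.Gamma ((n : ℂ) + 1 - m))⁻¹ *
    ((-1) ^ n * (Complex.exp (-l * (m / 2)) * jacobiPolyOrderDeriv n m (1 - (1 - (x : ℂ)) / 2))
      - Complex.exp (l * (m / 2)) * jacobiPolyOrderDeriv n m ((1 - (x : ℂ)) / 2))

theorem continuous_jacobiPolyOrderDeriv (n : ℕ) (μ : ℂ) : Continuous (jacobiPolyOrderDeriv n μ) := by
  unfold jacobiPolyOrderDeriv
  fun_prop

namespace ApproachesCut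

variable {F : Filter ℂ} {x : ℝ} {l : ℂ}

theorem tendsto_legendreP (h : ApproachesCut F x l) (n : ℕ) (μ : ℂ) :
    Tendsto (legendreP n μ) F (𝓝 (boundaryP n μ x l)) := by
  have hw : Tendsto (fun z : ℂ => (jacobiPoly n μ).eval ((1 - z) / 2)) F
      (𝓝 ((jacobiPoly n μ).eval ((1 - (x : ℂ)) / 2))) :=
    (Continuous.tendsto (by fun_prop) (x : ℂ)).mono_left h.le_nhds
  have hE := (h.tendsto_logRatio.mul_const (μ / 2)).cexp
  refine ((hE.mul hw).mul_const _).congr' ?_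
  filter_upwards [h.im_ne_zero] with z hz
  rw [legendreP_eq n μ hz]

theorem tendsto_legendreW (h : ApproachesCut F x l) {n m : ℕ} (hmn : m ≤ n) :
    Tendsto (legendreW n m) F (𝓝 (boundaryW n m x l)) := by
  have hc := continuous_jacobiPolyOrderDeriv n m
  have hw : Tendsto (fun z : ℂ => jacobiPolyOrderDeriv n m ((1 - z) / 2)) F
      (𝓝 (jacobiPolyOrderDeriv n m ((1 - (x : ℂ)) / 2))) :=
    (Continuous.tendsto (by fun_prop) (x : ℂ)).mono_left h.le_nhds
  have hw' : Tendsto (fun z : ℂ => jacobiPolyOrderDeriv n m (1 - (1 - z) / 2)) F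
      (𝓝 (jacobiPolyOrderDeriv n m (1 - (1 - (x : ℂ)) / 2))) :=
    (Continuous.tendsto (by fun_prop) (x : ℂ)).mono_left h.le_nhds
  have hE := (h.tendsto_logRatio.mul_const ((m : ℂ) / 2)).cexp
  have hE' := (h.tendsto_logRatio.neg.mul_const ((m : ℂ) / 2)).cexp
  refine ((((hE'.mul hw').const_mul ((-1) ^ n)).sub (hE.mul hw)).const_mul _).congr' ?_
  filter_upwards [h.im_ne_zero] with z hz
  rw [legendreW_eq hmn hz]

theorem tendsto_legendreQ (h : ApproachesCut F x l) {n m : ℕ} (hmn : m ≤ n) :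
    Tendsto (legendreQ n m) F (𝓝 (1 / 2 * boundaryP n m x l * l - boundaryW n m x l)) := by
  refine ((((h.tendsto_legendreP n m).const_mul (1 / 2)).mul h.tendsto_logRatio).sub
    (h.tendsto_legendreW hmn)).congr' ?_
  filter_upwards [h.im_ne_zero] with z hz
  rw [legendreQ_eq hmn hz]

end ApproachesCut

theorem ratio_ofReal_re_neg {x : ℝ} (hx : x ∈ Set.Ioo (-1 : ℝ) 1) : (x + 1) / (x - 1) < 0 :=
  div_neg_of_pos_of_neg (by linarith [hx.1]) (by linarith [hx.2])

theorem continuousAt_ratio {x : ℝ} (hx : x ∈ Set.Ioo (-1 : ℝ) 1) :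
    ContinuousAt (fun z : ℂ => (z + 1) / (z - 1)) (x : ℂ) := by
  refine ContinuousAt.div (by fun_prop) (by fun_prop) ?_
  rw [sub_ne_zero]
  exact_mod_cast hx.2.ne

theorem log_norm_ratio {x : ℝ} (hx : x ∈ Set.Ioo (-1 : ℝ) 1) :
    Real.log ‖((x : ℂ) + 1) / (x - 1)‖ = Real.log ((1 + x) / (1 - x)) := by
  have h : ((x : ℂ) + 1) / (x - 1) = (((x + 1) / (x - 1) : ℝ) : ℂ) := by push_cast; ring
  rw [h, Complex.norm_real, Real.norm_of_nonpos (ratio_ofReal_re_neg hx).le, ← div_neg]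
  congr 2 <;> ring

/-- The ratio maps the upper half-plane to the lower one, so the negative axis is approached from
below; hence `-πi`. -/
theorem approachesCut_nhdsAbove {x : ℝ} (hx : x ∈ Set.Ioo (-1 : ℝ) 1) :
    ApproachesCut (nhdsAbove x) x (Real.log ((1 + x) / (1 - x)) - Real.pi * Complex.I) where
  neBot := by
    rw [nhdsAbove, ← mem_closure_iff_nhdsWithin_neBot, Complex.closure_setOfPred_lt_im]
    simp
  le_nhds := nhdsWithin_le_nhds
  im_ne_zero := by
    filter_upwards [self_mem_nhdsWithin] with z hz
    exact (show 0 < z.im from hz).ne'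
  tendsto_logRatio := by
    have h : ((x : ℂ) + 1) / (x - 1) = (((x + 1) / (x - 1) : ℝ) : ℂ) := by push_cast; ring
    have h1 := Complex.tendsto_log_nhdsWithin_im_neg_of_re_neg_of_im_zero
      (z := ((x : ℂ) + 1) / (x - 1)) (by rw [h]; exact ratio_ofReal_re_neg hx) (by rw [h]; exact Complex.ofReal_im _)
    rw [log_norm_ratio hx] at h1
    refine h1.comp (tendsto_nhdsWithin_iff.2
      ⟨(continuousAt_ratio hx).tendsto.mono_left nhdsWithin_le_nhds, ?_⟩)
    filter_upwards [self_mem_nhdsWithin] with z hz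
    have hz' : 0 < z.im := hz
    have := Complex.normSq_pos.2 (sub_one_ne_zero_of_im_ne_zero hz'.ne')
    simp only [ratio_im]
    exact div_neg_of_neg_of_pos (by linarith) this

theorem approachesCut_nhdsBelow {x : ℝ} (hx : x ∈ Set.Ioo (-1 : ℝ) 1) :
    ApproachesCut (nhdsBelow x) x (Real.log ((1 + x) / (1 - x)) + Real.pi * Complex.I) where
  neBot := by
    rw [nhdsBelow, ← mem_closure_iff_nhdsWithin_neBot, Complex.closure_setOfPred_im_lt]
    simp
  le_nhds := nhdsWithin_le_nhds
  im_ne_zero := by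
    filter_upwards [self_mem_nhdsWithin] with z hz
    exact (show z.im < 0 from hz).ne
  tendsto_logRatio := by
    have h : ((x : ℂ) + 1) / (x - 1) = (((x + 1) / (x - 1) : ℝ) : ℂ) := by push_cast; ring
    have h1 := Complex.tendsto_log_nhdsWithin_im_nonneg_of_re_neg_of_im_zero
      (z := ((x : ℂ) + 1) / (x - 1)) (by rw [h]; exact ratio_ofReal_re_neg hx) (by rw [h]; exact Complex.ofReal_im _)
    rw [log_norm_ratio hx] at h1
    refine h1.comp (tendsto_nhdsWithin_iff.2
      ⟨(continuousAt_ratio hx).tendsto.mono_left nhdsWithin_le_nhds, ?_⟩)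
    filter_upwards [self_mem_nhdsWithin] with z hz
    have hz' : z.im < 0 := hz
    have := Complex.normSq_pos.2 (sub_one_ne_zero_of_im_ne_zero hz'.ne)
    simp only [ratio_im]
    exact (div_pos (by linarith) this).le

theorem valueAbove_eq {f : ℂ → ℂ} {x : ℝ} {a : ℂ} (hx : x ∈ Set.Ioo (-1 : ℝ) 1)
    (h : Tendsto f (nhdsAbove x) (𝓝 a)) : valueAbove f x = a :=
  haveI := (approachesCut_nhdsAbove hx).neBot
  h.limUnder_eq

theorem valueBelow_eq {f : ℂ → ℂ} {x : ℝ} {a : ℂ} (hx : x ∈ Set.Ioo (-1 : ℝ) 1)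
    (h : Tendsto f (nhdsBelow x) (𝓝 a)) : valueBelow f x = a :=
  haveI := (approachesCut_nhdsBelow hx).neBot
  h.limUnder_eq

/-! ### The functions on the cut. -/

/-- The factor `((1 + x) / (1 - x)) ^ (μ / 2)`. -/
def cutPower (μ : ℂ) (x : ℝ) : ℂ :=
  Complex.exp ((Real.log ((1 + x) / (1 - x)) : ℂ) * (μ / 2))

theorem cutPower_neg_left (μ : ℂ) (x : ℝ) : cutPower (-μ) x = (cutPower μ x)⁻¹ := by
  rw [cutPower, cutPower, ← Complex.exp_neg]
  congr 1; ring

theorem cutPower_neg_right (μ : ℂ) (x : ℝ) : cutPower μ (-x) = (cutPower μ x)⁻¹ := by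
  rw [cutPower, cutPower, ← Complex.exp_neg, show (1 + -x) / (1 - -x) = ((1 + x) / (1 - x))⁻¹ by
    rw [inv_div]; congr 1; ring, Real.log_inv]
  push_cast
  congr 1; ring

theorem cutPower_ne_zero (μ : ℂ) (x : ℝ) : cutPower μ x ≠ 0 := Complex.exp_ne_zero _

theorem ferrersP_eq (n : ℕ) (μ : ℂ) {x : ℝ} (hx : x ∈ Set.Ioo (-1 : ℝ) 1) :
    ferrersP n μ x = cutPower μ x * (jacobiPoly n μ).eval ((1 - (x : ℂ)) / 2)
      * (Complex.Gamma ((n : ℂ) + 1 - μ))⁻¹ := by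
  rw [ferrersP, valueAbove_eq hx ((approachesCut_nhdsAbove hx).tendsto_legendreP n μ),
    valueBelow_eq hx ((approachesCut_nhdsBelow hx).tendsto_legendreP n μ), boundaryP, boundaryP,
    cutPower]
  simp only [← mul_assoc, ← Complex.exp_add]
  ring_nf

theorem exp_I_pi_mul_natCast_div_two_mul_self (m : ℕ) :
    Complex.exp (Complex.I * Real.pi * m / 2) * Complex.exp (Complex.I * Real.pi * m / 2) =
      (-1) ^ m := by
  rw [← Complex.exp_add, show Complex.I * Real.pi * m / 2 + Complex.I * Real.pi * m / 2 =
    m * (Real.pi * Complex.I) by ring, Complex.exp_nat_mul, Complex.exp_pi_mul_I]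

theorem exp_sub_pi_mul_I_mul (l : ℂ) (m : ℕ) :
    Complex.exp ((l - Real.pi * Complex.I) * (m / 2)) =
      Complex.exp (l * (m / 2)) * (Complex.exp (Complex.I * Real.pi * m / 2))⁻¹ := by
  rw [← Complex.exp_neg, ← Complex.exp_add]; congr 1; ring

theorem exp_add_pi_mul_I_mul (l : ℂ) (m : ℕ) :
    Complex.exp ((l + Real.pi * Complex.I) * (m / 2)) =
      Complex.exp (l * (m / 2)) * Complex.exp (Complex.I * Real.pi * m / 2) := by
  rw [← Complex.exp_add]; congr 1; ring

/-- The prescribed phases cancel those of the reflected term and double those of the other;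
`e^{±iπm}` are both `(-1) ^ m`. -/
theorem ferrersW_eq {n m : ℕ} (hmn : m ≤ n) {x : ℝ} (hx : x ∈ Set.Ioo (-1 : ℝ) 1) :
    ferrersW n m x = 1 / 2 * (Complex.Gamma ((n : ℂ) + 1 - m))⁻¹ *
      ((-1) ^ (n + m) * ((cutPower m x)⁻¹ * jacobiPolyOrderDeriv n m (1 - (1 - (x : ℂ)) / 2))
        - cutPower m x * jacobiPolyOrderDeriv n m ((1 - (x : ℂ)) / 2)) := by
  rw [ferrersW, valueAbove_eq hx ((approachesCut_nhdsAbove hx).tendsto_legendreW hmn),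
    valueBelow_eq hx ((approachesCut_nhdsBelow hx).tendsto_legendreW hmn), boundaryW, boundaryW,
    cutPower]
  simp only [neg_mul, Complex.exp_neg, exp_sub_pi_mul_I_mul, exp_add_pi_mul_I_mul]
  have hc := exp_I_pi_mul_natCast_div_two_mul_self m
  have hc0 := Complex.exp_ne_zero (Complex.I * Real.pi * m / 2)
  have hE := Complex.exp_ne_zero ((Real.log ((1 + x) / (1 - x)) : ℂ) * (m / 2))
  have hs := neg_one_pow_mul_self m
  generalize Complex.exp (Complex.I * Real.pi * m / 2) = c at *
  generalize Complex.exp ((Real.log ((1 + x) / (1 - x)) : ℂ) * (m / 2)) = E at *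
  generalize jacobiPolyOrderDeriv n m (1 - (1 - (x : ℂ)) / 2) = a
  generalize jacobiPolyOrderDeriv n m ((1 - (x : ℂ)) / 2) = b
  generalize (Complex.Gamma ((n : ℂ) + 1 - m))⁻¹ = G
  have hci : c⁻¹ * c⁻¹ = (-1) ^ m := by
    rw [← mul_inv, hc, ← inv_pow]; norm_num
  have h1 : c⁻¹ * c = 1 := inv_mul_cancel₀ hc0
  rw [pow_add, mul_inv, mul_inv, inv_inv]
  generalize E⁻¹ = E'
  generalize c⁻¹ = c' at *
  generalize (-1 : ℂ) ^ m = s at *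
  generalize (-1 : ℂ) ^ n = t at *
  linear_combination (s / 2 * G * t * E' * a) * h1 - (s / 4 * G * E * b) * (hci + hc)
    - (1 / 2 * G * E * b) * hs

/-- At integer order the `P` terms from both sides carry the same total phase, so `-πi` and `+πi`
from the logarithms cancel. -/
theorem ferrersQ_eq {n m : ℕ} (hmn : m ≤ n) {x : ℝ} (hx : x ∈ Set.Ioo (-1 : ℝ) 1) :
    ferrersQ n m x =
      1 / 2 * ferrersP n m x * (Real.log ((1 + x) / (1 - x)) : ℂ) - ferrersW n m x := by
  rw [ferrersQ, ferrersP_eq n m hx, ferrersW,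
    valueAbove_eq hx ((approachesCut_nhdsAbove hx).tendsto_legendreQ hmn),
    valueBelow_eq hx ((approachesCut_nhdsBelow hx).tendsto_legendreQ hmn),
    valueAbove_eq hx ((approachesCut_nhdsAbove hx).tendsto_legendreW hmn),
    valueBelow_eq hx ((approachesCut_nhdsBelow hx).tendsto_legendreW hmn), boundaryP, boundaryP,
    cutPower]
  rw [show -(Complex.I * Real.pi * m) =
    -(Complex.I * Real.pi * m / 2) + -(Complex.I * Real.pi * m / 2) by ring, Complex.exp_add]
  simp only [Complex.exp_neg, exp_sub_pi_mul_I_mul, exp_add_pi_mul_I_mul]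
  have hc := exp_I_pi_mul_natCast_div_two_mul_self m
  have hc0 := Complex.exp_ne_zero (Complex.I * Real.pi * m / 2)
  have hs := neg_one_pow_mul_self m
  generalize Complex.exp (Complex.I * Real.pi * m / 2) = c at *
  generalize boundaryW n m x _ = W₁
  generalize boundaryW n m x _ = W₂
  have hci : c⁻¹ * c⁻¹ = (-1) ^ m := by
    rw [← mul_inv, hc, ← inv_pow]; norm_num
  generalize (Real.log ((1 + x) / (1 - x)) : ℂ) = l at *
  generalize Complex.exp (l * (m / 2)) = E at *
  generalize (jacobiPoly n (m : ℂ)).eval ((1 - (x : ℂ)) / 2) = b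
  generalize (Complex.Gamma ((n : ℂ) + 1 - m))⁻¹ = G
  generalize c⁻¹ = c' at *
  generalize (-1 : ℂ) ^ m = s at *
  rw [hci]
  linear_combination (s / 4 * E * b * G) * ((l - Real.pi * Complex.I) * hci
    + (l + Real.pi * Complex.I) * hc) + (1 / 2 * E * b * G * l) * hs

/-! ### The explicit sum for `W` on the cut. -/

theorem Gamma_natCast_add_one_sub {n m : ℕ} (h : m ≤ n) :
    Complex.Gamma ((n : ℂ) + 1 - m) = ((n - m)! : ℂ) := by
  rw [← Complex.Gamma_nat_eq_factorial, Nat.cast_sub h]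
  congr 1; ring

theorem ferrersP_natCast {k m : ℕ} (h : m ≤ k) {x : ℝ} (hx : x ∈ Set.Ioo (-1 : ℝ) 1) :
    ferrersP k m x = cutPower m x * (jacobiPoly k (m : ℂ)).eval ((1 - (x : ℂ)) / 2)
      / ((k - m)! : ℂ) := by
  rw [ferrersP_eq k m hx, Gamma_natCast_add_one_sub h]
  exact (div_eq_mul_inv _ _).symm

theorem ferrersP_neg_natCast (k m : ℕ) {x : ℝ} (hx : x ∈ Set.Ioo (-1 : ℝ) 1) :
    ferrersP k (-(m : ℂ)) x = (-1) ^ k * ((cutPower m x)⁻¹ *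
      (jacobiPoly k (m : ℂ)).eval (1 - (1 - (x : ℂ)) / 2)) / ((k + m)! : ℂ) := by
  have h := jacobiPoly_neg_eval_one_sub k m (1 - (1 - (x : ℂ)) / 2)
  rw [sub_sub_cancel] at h
  rw [ferrersP_eq k _ hx, cutPower_neg_left, h, ← Complex.Gamma_nat_eq_factorial,
    show (k : ℂ) + 1 - -(m : ℂ) = ((k + m : ℕ) : ℂ) + 1 by push_cast; ring]
  ring

theorem neg_mem_Ioo {x : ℝ} (hx : x ∈ Set.Ioo (-1 : ℝ) 1) : -x ∈ Set.Ioo (-1 : ℝ) 1 :=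
  ⟨by linarith [hx.2], by linarith [hx.1]⟩

theorem ferrersP_neg_natCast_neg (k m : ℕ) {x : ℝ} (hx : x ∈ Set.Ioo (-1 : ℝ) 1) :
    ferrersP k (-(m : ℂ)) (-x) = (-1) ^ k * (cutPower m x *
      (jacobiPoly k (m : ℂ)).eval ((1 - (x : ℂ)) / 2)) / ((k + m)! : ℂ) := by
  rw [ferrersP_neg_natCast k m (neg_mem_Ioo hx), cutPower_neg_right, inv_inv]
  push_cast
  rw [one_sub_neg_div_two, sub_sub_cancel]

theorem cutPower_natCast_mul_self (m : ℕ) {x : ℝ} (hx : x ∈ Set.Ioo (-1 : ℝ) 1) :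
    cutPower m x * cutPower m x = ((1 - (1 - (x : ℂ)) / 2) / ((1 - (x : ℂ)) / 2)) ^ m := by
  have h : 0 < (1 + x) / (1 - x) := div_pos (by linarith [hx.1]) (by linarith [hx.2])
  have h1 : (1 - (x : ℂ)) ≠ 0 := by
    rw [sub_ne_zero]; exact_mod_cast hx.2.ne'
  rw [cutPower, ← Complex.exp_add, ← mul_add, add_halves, mul_comm, Complex.exp_nat_mul,
    ← Complex.ofReal_exp, Real.exp_log h]
  push_cast
  congr 1
  field_simp
  ring

theorem cutPower_inv_mul_jacobiPoly {k m : ℕ} (h : m ≤ k) {x : ℝ} (hx : x ∈ Set.Ioo (-1 : ℝ) 1) :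
    (cutPower m x)⁻¹ * (jacobiPoly k (m : ℂ)).eval (1 - (1 - (x : ℂ)) / 2) =
      (-1) ^ (k + m) * (cutPower m x * (jacobiPoly k (m : ℂ)).eval ((1 - (x : ℂ)) / 2)) := by
  have h1 := jacobiPoly_natCast_eval_one_sub h ((1 - (x : ℂ)) / 2)
  have e := cutPower_natCast_mul_self m hx
  have hE := cutPower_ne_zero m x
  have hw : (1 - (x : ℂ)) / 2 ≠ 0 := by
    apply div_ne_zero _ two_ne_zero
    rw [sub_ne_zero]; exact_mod_cast hx.2.ne'
  generalize cutPower m x = E at *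
  generalize (1 - (x : ℂ)) / 2 = w at *
  have hwm : w ^ m ≠ 0 := pow_ne_zero _ hw
  rw [div_pow, eq_div_iff hwm] at e
  rw [inv_mul_eq_iff_eq_mul₀ hE]
  apply mul_left_cancel₀ hwm
  rw [h1]
  linear_combination -(-1) ^ (k + m) * (jacobiPoly k (m : ℂ)).eval w * e

theorem orderDerivCoeff_natCast_of_lt {n m k : ℕ} (hk : k < m) (hmn : m ≤ n) :
    orderDerivCoeff n k m = -((2 * (k : ℂ) + 1) / (((n : ℂ) - k) * ((k : ℂ) + n + 1)) *
      (((n + m)! : ℂ) / ((k + m)! : ℂ))) := by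
  rw [orderDerivCoeff, shiftedRising_natCast_of_lt hk hmn,
    shiftedRising_neg_natCast m (hk.le.trans hmn)]
  ring

theorem orderDerivCoeff_natCast_of_le {n m k : ℕ} (hk : m ≤ k) (hkn : k ≤ n) :
    orderDerivCoeff n k m = (2 * (k : ℂ) + 1) / (((n : ℂ) - k) * ((k : ℂ) + n + 1)) *
      ((-1) ^ (n - k) * (((n - m)! : ℂ) / ((k - m)! : ℂ)) - ((n + m)! : ℂ) / ((k + m)! : ℂ)) := by
  rw [orderDerivCoeff, shiftedRising_natCast_of_le hk hkn, shiftedRising_neg_natCast m hkn]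

/-- The contribution of `jacobiPoly k m` to `ferrersW n m x`. -/
def ferrersWTerm (n m k : ℕ) (x : ℝ) : ℂ :=
  1 / 2 * (((n - m)! : ℂ))⁻¹ * (orderDerivCoeff n k m *
    ((-1) ^ (n + m) * ((cutPower m x)⁻¹ * (jacobiPoly k (m : ℂ)).eval (1 - (1 - (x : ℂ)) / 2))
      - cutPower m x * (jacobiPoly k (m : ℂ)).eval ((1 - (x : ℂ)) / 2)))

theorem ferrersW_eq_sum {n m : ℕ} (hmn : m ≤ n) {x : ℝ} (hx : x ∈ Set.Ioo (-1 : ℝ) 1) :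
    ferrersW n m x = ∑ k ∈ Finset.range n, ferrersWTerm n m k x := by
  rw [ferrersW_eq hmn hx, Gamma_natCast_add_one_sub hmn]
  simp only [ferrersWTerm, jacobiPolyOrderDeriv]
  simp only [Finset.mul_sum, ← Finset.sum_sub_distrib]
  exact Finset.sum_congr rfl fun k _ => by ring

theorem ferrersWTerm_of_lt {n m k : ℕ} (hk : k < m) (hmn : m ≤ n) {x : ℝ}
    (hx : x ∈ Set.Ioo (-1 : ℝ) 1) :
    ferrersWTerm n m k x = 1 / 2 * (((n + m)! : ℂ) / ((n - m)! : ℂ)) *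
      ((-1) ^ k * ((2 * (k : ℂ) + 1) / (((n : ℂ) - k) * ((k : ℂ) + n + 1))) *
        (ferrersP k (-(m : ℂ)) (-x) - (-1) ^ (n + m) * ferrersP k (-(m : ℂ)) x)) := by
  rw [ferrersWTerm, orderDerivCoeff_natCast_of_lt hk hmn, ferrersP_neg_natCast k m hx,
    ferrersP_neg_natCast_neg k m hx]
  generalize cutPower m x * (jacobiPoly k (m : ℂ)).eval ((1 - (x : ℂ)) / 2) = a
  generalize (cutPower m x)⁻¹ * (jacobiPoly k (m : ℂ)).eval (1 - (1 - (x : ℂ)) / 2) = b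
  generalize (2 * (k : ℂ) + 1) / (((n : ℂ) - k) * ((k : ℂ) + n + 1)) = d
  linear_combination (-(1 / 2 * (((n + m)! : ℂ) / ((n - m)! : ℂ)) * d / ((k + m)! : ℂ)
    * (a - (-1) ^ (n + m) * b))) * neg_one_pow_mul_self k

/-- Reflection turns the bracket into `(-1) ^ (n - k) - 1` times one value. Multiplying by the
two-term coefficient pulls out `1 - (-1) ^ (n - k)`, as the sign squares to one. -/
theorem ferrersWTerm_of_le {n m k : ℕ} (hk : m ≤ k) (hkn : k ≤ n) {x : ℝ}
    (hx : x ∈ Set.Ioo (-1 : ℝ) 1) :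
    ferrersWTerm n m k x = 1 / 2 * (1 - (-1) ^ (n - k)) *
      ((2 * (k : ℂ) + 1) / (((n : ℂ) - k) * ((k : ℂ) + n + 1)) *
        (1 + ((n + m)! : ℂ) * ((k - m)! : ℂ) / (((n - m)! : ℂ) * ((k + m)! : ℂ))) *
          ferrersP k m x) := by
  have h1 : ((k - m)! : ℂ) ≠ 0 := by exact_mod_cast Nat.factorial_ne_zero _
  have h2 : ((n - m)! : ℂ) ≠ 0 := by exact_mod_cast Nat.factorial_ne_zero _
  have h3 : ((k + m)! : ℂ) ≠ 0 := by exact_mod_cast Nat.factorial_ne_zero _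
  rw [ferrersWTerm, orderDerivCoeff_natCast_of_le hk hkn, ferrersP_natCast hk hx,
    cutPower_inv_mul_jacobiPoly hk hx]
  have hs : (-1 : ℂ) ^ (n + m) * (-1) ^ (k + m) = (-1) ^ (n - k) := by
    rw [← pow_add, show n + m + (k + m) = (n - k) + 2 * (k + m) by omega, pow_add, pow_mul]
    simp
  have ht := neg_one_pow_mul_self (n - k)
  generalize cutPower m x * (jacobiPoly k (m : ℂ)).eval ((1 - (x : ℂ)) / 2) = a
  generalize (2 * (k : ℂ) + 1) / (((n : ℂ) - k) * ((k : ℂ) + n + 1)) = d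
  rw [← mul_assoc ((-1 : ℂ) ^ (n + m)), hs]
  generalize (-1 : ℂ) ^ (n - k) = t at *
  field_simp
  linear_combination (a * d * ((n - m)! : ℂ) * ((k + m)! : ℂ)) * ht

theorem sum_range_add_eq_sum_odd {M : Type*} [AddCommMonoid M] (f : ℕ → M) {n m : ℕ} (hmn : m ≤ n)
    (hf : ∀ k, k < n → Even (n - k) → f k = 0) :
    ∑ k ∈ Finset.range (n - m), f (m + k) =
      ∑ k ∈ Finset.range ((n - m + 1) / 2), f (n - 2 * k - 1) := by
  symm
  refine Finset.sum_of_injOn (fun k => n - m - 2 * k - 1) ?_ ?_ ?_ ?_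
  · intro a ha b hb h
    simp only [Finset.coe_range, Set.mem_Iio] at ha hb h
    omega
  · intro a ha
    simp only [Finset.coe_range, Set.mem_Iio] at ha ⊢
    omega
  · intro k hk hk'
    rw [Finset.mem_range] at hk
    apply hf _ (by omega)
    by_contra hodd
    rw [Nat.not_even_iff_odd] at hodd
    obtain ⟨r, hr⟩ := hodd
    refine hk' ⟨r, ?_, ?_⟩
    · simp only [Finset.coe_range, Set.mem_Iio]
      omega
    · show n - m - 2 * r - 1 = k
      omega
  · intro k hk
    rw [Finset.mem_range] at hk
    congr 1
    omega

theorem ferrersW_eq_sum_ferrersP {n m : ℕ} (hmn : m ≤ n) {x : ℝ} (hx : x ∈ Set.Ioo (-1 : ℝ) 1) :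
    ferrersW n m x =
      1 / 2 * (((n + m)! : ℂ) / ((n - m)! : ℂ)) *
          ∑ k ∈ Finset.range m,
            (-1) ^ k * ((2 * (k : ℂ) + 1) / (((n : ℂ) - k) * ((k : ℂ) + n + 1))) *
              (ferrersP k (-(m : ℂ)) (-x) - (-1) ^ (n + m) * ferrersP k (-(m : ℂ)) x)
        + 1 / 2 * ∑ k ∈ Finset.range ((n - m + 1) / 2),
            (2 * (n : ℂ) - 4 * k - 1) / (((n : ℂ) - k) * (2 * (k : ℂ) + 1)) *
              (1 + ((n + m)! : ℂ) * ((n - m - 2 * k - 1)! : ℂ) /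
                (((n - m)! : ℂ) * ((n + m - 2 * k - 1)! : ℂ))) *
              ferrersP (n - 2 * k - 1) m x := by
  have hsplit := Finset.sum_range_add (fun k => ferrersWTerm n m k x) m (n - m)
  rw [Nat.add_sub_cancel' hmn] at hsplit
  rw [ferrersW_eq_sum hmn hx, hsplit, Finset.mul_sum, Finset.mul_sum]
  congr 1
  · exact Finset.sum_congr rfl fun k hk => ferrersWTerm_of_lt (Finset.mem_range.1 hk) hmn hx
  -- The value `0` for `k < m` meets the vanishing hypothesis there; the shifted sum never reaches
  -- those degrees.
  · have hodd := sum_range_add_eq_sum_odd (fun k => if m ≤ k then ferrersWTerm n m k x else 0) hmn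
      (fun k hk he => by
        split_ifs with h
        · rw [ferrersWTerm_of_le h hk.le hx, he.neg_one_pow]; ring
        · rfl)
    simp only [le_add_iff_nonneg_right, zero_le, if_true] at hodd
    rw [hodd]
    refine Finset.sum_congr rfl fun k hk => ?_
    have hk' := Finset.mem_range.1 hk
    have hmk : m ≤ n - 2 * k - 1 := by omega
    rw [if_pos hmk, ferrersWTerm_of_le hmk (by omega) hx,
      show n - (n - 2 * k - 1) = 2 * k + 1 by omega,
      show n - 2 * k - 1 - m = n - m - 2 * k - 1 by omega,
      show n - 2 * k - 1 + m = n + m - 2 * k - 1 by omega, pow_succ, pow_mul]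
    have hcast : ((n - 2 * k - 1 : ℕ) : ℂ) = (n : ℂ) - 2 * k - 1 := by
      rw [Nat.cast_sub (by omega), Nat.cast_sub (by omega)]; push_cast; ring
    have h1 : (n : ℂ) - k ≠ 0 := by
      rw [sub_ne_zero]; exact_mod_cast (by omega : n ≠ k)
    have h2 : 2 * (k : ℂ) + 1 ≠ 0 := by exact_mod_cast Nat.succ_ne_zero (2 * k)
    -- The trailing `2` is `1 - (-1) ^ (2 * k + 1)`; it cancels the `2` in `2 * (n - k)`.
    have hcoef : (2 * ((n : ℂ) - 2 * k - 1) + 1) / (((n : ℂ) - ((n : ℂ) - 2 * k - 1)) *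
        (((n : ℂ) - 2 * k - 1) + n + 1)) * 2 =
        (2 * (n : ℂ) - 4 * k - 1) / (((n : ℂ) - k) * (2 * (k : ℂ) + 1)) := by
      rw [show (n : ℂ) - ((n : ℂ) - 2 * k - 1) = 2 * k + 1 by ring,
        show (n : ℂ) - 2 * k - 1 + n + 1 = 2 * (n - k) by ring]
      field_simp
      ring
    rw [hcast, ← hcoef]
    norm_num
    ring

theorem hasBoundaryValues_legendreP (k : ℕ) (μ : ℂ) {x : ℝ} (hx : x ∈ Set.Ioo (-1 : ℝ) 1) :
    HasBoundaryValues (legendreP k μ) x :=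
  ⟨⟨_, (approachesCut_nhdsAbove hx).tendsto_legendreP k μ⟩,
    ⟨_, (approachesCut_nhdsBelow hx).tendsto_legendreP k μ⟩⟩

theorem hasBoundaryValues_legendreQ {n m : ℕ} (hmn : m ≤ n) {x : ℝ}
    (hx : x ∈ Set.Ioo (-1 : ℝ) 1) : HasBoundaryValues (legendreQ n m) x :=
  ⟨⟨_, (approachesCut_nhdsAbove hx).tendsto_legendreQ hmn⟩,
    ⟨_, (approachesCut_nhdsBelow hx).tendsto_legendreQ hmn⟩⟩

theorem hasBoundaryValues_legendreW {n m : ℕ} (hmn : m ≤ n) {x : ℝ}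
    (hx : x ∈ Set.Ioo (-1 : ℝ) 1) : HasBoundaryValues (legendreW n m) x :=
  ⟨⟨_, (approachesCut_nhdsAbove hx).tendsto_legendreW hmn⟩,
    ⟨_, (approachesCut_nhdsBelow hx).tendsto_legendreW hmn⟩⟩

end

theorem mainTheorem11 (n m : ℕ) (hmn : m ≤ n) (x : ℝ) (hx : x ∈ Set.Ioo (-1 : ℝ) 1) :
    -- the quantities on both sides exist: the derivative with respect to the order and the
    -- limiting value that defines the function of the second kind off the real line ...
    (∀ z : ℂ, z.im ≠ 0 →
      DifferentiableAt ℂ (fun μ : ℂ => legendreP n μ z) m ∧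
      ∃ L : ℂ, Tendsto (legendreQAux n z) (𝓝[≠] (m : ℂ)) (𝓝 L)) ∧
    -- ... and the boundary values on the two sides of the cut
    (∀ (k : ℕ) (μ : ℂ),
      HasBoundaryValues (legendreP k μ) x ∧ HasBoundaryValues (legendreP k μ) (-x)) ∧
    HasBoundaryValues (legendreQ n m) x ∧
    HasBoundaryValues (legendreW n m) x ∧
    -- the representation of the function of the second kind on the cut
    ferrersQ n m x =
      1 / 2 * ferrersP n m x * (Real.log ((1 + x) / (1 - x)) : ℂ) - ferrersW n m x ∧
    -- the explicit form of `W_{n-1}^m(x)`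
    ferrersW n m x =
      1 / 2 * (((n + m)! : ℂ) / ((n - m)! : ℂ)) *
          ∑ k ∈ Finset.range m,
            (-1) ^ k * ((2 * (k : ℂ) + 1) / (((n : ℂ) - k) * ((k : ℂ) + n + 1))) *
              (ferrersP k (-(m : ℂ)) (-x) - (-1) ^ (n + m) * ferrersP k (-(m : ℂ)) x)
        + 1 / 2 * ∑ k ∈ Finset.range ((n - m + 1) / 2),
            (2 * (n : ℂ) - 4 * k - 1) / (((n : ℂ) - k) * (2 * (k : ℂ) + 1)) *
              (1 + ((n + m)! : ℂ) * ((n - m - 2 * k - 1)! : ℂ) /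
                (((n - m)! : ℂ) * ((n + m - 2 * k - 1)! : ℂ))) *
              ferrersP (n - 2 * k - 1) m x := by
  exact ⟨fun z hz => ⟨(hasDerivAt_legendreP n m hz).differentiableAt, _,
      tendsto_legendreQAux hmn hz⟩,
    fun k μ => ⟨hasBoundaryValues_legendreP k μ hx,
      hasBoundaryValues_legendreP k μ (neg_mem_Ioo hx)⟩,
    hasBoundaryValues_legendreQ hmn hx, hasBoundaryValues_legendreW hmn hx,
    ferrersQ_eq hmn hx, ferrersW_eq_sum_ferrersP hmn hx⟩
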